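/- Semigroups are nonempty. A pseudovariety of finite semigroups is a class of finite semigroups closed under finite direct products (including the empty product), subsemigroups and homomorphic images; let $\mathbf{PV}$ be the complete lattice of all pseudovarieties, ordered by inclusion. Let $\mathbf{Cnt}(\mathbf{PV})$ be the set of all continuous maps $\alpha\colon\mathbf{PV}\to\mathbf{PV}$ (order preserving and commuting with joins of nonempty directed sets), ordered pointwise, and let $\mathbf{Cnt}(\mathbf{PV})^-=\{\alpha\in\mathbf{Cnt}(\mathbf{PV})\mid \alpha(\mathbf V)\subseteq\mathbf V\text{ for all }\mathbf V\in\mathbf{PV}\}$. A relational morphism $f\colon S\to T$ of finite semigroups is a map $f\colon S\to 2^T$ with $sf\neq\emptyset$ and $s_1f\cdot s_2f\subseteq (s_1s_2)f$ for all $s,s_1,s_2\in S$; it is a division if $sf\cap s'f\neq\emptyset$ implies $s=s'$. Composites are written from left to right. A continuously closed class is a class $\mathsf R$ of relational morphisms of finite semigroups that contains the identity of the trivial semigroup, is closed under direct products $f\times g$, and contains $f\colon S\to T$ whenever there are $g\colon U\to V$ in $\mathsf R$ and divisions $d_1\colon S\to U$, $d_2\colon V\to T$ with $sf\subseteq s(d_1gd_2)$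 for all $s\in S$. Let $\mathbf{CC}$ be the set of all continuously closed classes, ordered by inclusion, and let $\mathbf{CC}^-=\{\mathsf R\in\mathbf{CC}\mid \mathsf R\subseteq\mathsf D\}$, where $\mathsf D\in\mathbf{CC}$ is the class of all divisions. Then each of $\mathbf{CC}$, $\mathbf{CC}^-$, $\mathbf{Cnt}(\mathbf{PV})$ and $\mathbf{Cnt}(\mathbf{PV})^-$ is an algebraic lattice (a complete lattice in which every element is a join of compact elements) and has no atoms, i.e. the set of its elements different from the bottom has no minimal element. -/

import Mathlib

/-- A (nonempty) finite semigroup. -/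
structure FinSgp : Type 1 where
  carrier : Type
  [semigroup : Semigroup carrier]
  [finite : Finite carrier]
  [nonempty : Nonempty carrier]

namespace FinSgp

instance : CoeSort FinSgp Type := ⟨FinSgp.carrier⟩

instance (S : FinSgp) : Semigroup S := S.semigroup
instance (S : FinSgp) : Finite S := S.finite
instance (S : FinSgp) : Nonempty S := S.nonempty

/-- The trivial semigroup. -/
def triv : FinSgp := ⟨Unit⟩

/-- The direct product of two finite semigroups. -/
def prod (S T : FinSgp) : FinSgp := ⟨S × T⟩

end FinSgp

/-- A pseudovariety of finite semigroups: a class of finite semigroups closed under finite direct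
products (including the empty one), subsemigroups and homomorphic images. -/
structure PV : Type 1 where
  carrier : Set FinSgp
  triv_mem : FinSgp.triv ∈ carrier
  prod_mem : ∀ {S T : FinSgp}, S ∈ carrier → T ∈ carrier → S.prod T ∈ carrier
  sub_mem : ∀ {S T : FinSgp} (f : S →ₙ* T), Function.Injective f → T ∈ carrier → S ∈ carrier
  quot_mem : ∀ {S T : FinSgp} (f : S →ₙ* T), Function.Surjective f → S ∈ carrier → T ∈ carrier

namespace PV

theorem carrier_injective : Function.Injective PV.carrier := by
  rintro ⟨a, _⟩ ⟨b, _⟩ h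
  cases h
  rfl

/-- Pseudovarieties are ordered by inclusion. -/
instance : PartialOrder PV := PartialOrder.lift PV.carrier carrier_injective

/-- The infimum of a family of pseudovarieties is their intersection. -/
instance : InfSet PV where
  sInf A :=
    { carrier := {S | ∀ V ∈ A, S ∈ V.carrier}
      triv_mem := fun V _ => V.triv_mem
      prod_mem := fun hS hT V hV => V.prod_mem (hS V hV) (hT V hV)
      sub_mem := fun f hf hT V hV => V.sub_mem f hf (hT V hV)
      quot_mem := fun f hf hS V hV => V.quot_mem f hf (hS V hV) }

/-- The complete lattice `PV`. -/
instance : CompleteLattice PV :=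
  completeLatticeOfInf PV fun _ =>
    ⟨fun V hV _ hS => hS V hV, fun _ hW _ hS _ hV => hW hV hS⟩

end PV

/-- A continuous self-map of the lattice `PV`: order preserving and commuting with directed joins
(order preservation is a consequence of Mathlib's `ScottContinuous`). -/
structure CntPV : Type 1 where
  toFun : PV → PV
  continuous : ScottContinuous toFun

namespace CntPV

theorem toFun_injective : Function.Injective CntPV.toFun := by
  rintro ⟨a, _⟩ ⟨b, _⟩ h
  cases h
  rfl

/-- Continuous operators are ordered pointwise. -/
instance : PartialOrder CntPV := PartialOrder.lift CntPV.toFun toFun_injective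

/-- Suprema of continuous operators are computed pointwise. -/
instance : SupSet CntPV where
  sSup A :=
    { toFun := fun V => sSup ((fun α : CntPV => α.toFun V) '' A)
      continuous := by
        intro d hne hdir V hV
        constructor
        · rintro _ ⟨W, hW, rfl⟩
          apply sSup_le
          rintro _ ⟨α, hα, rfl⟩
          exact (α.continuous.monotone (hV.1 hW)).trans (le_sSup ⟨α, hα, rfl⟩)
        · intro U hU
          apply sSup_le
          rintro _ ⟨α, hα, rfl⟩
          apply (α.continuous hne hdir hV).2
          rintro _ ⟨W, hW, rfl⟩
          exact le_trans (le_sSup (Set.mem_image_of_mem (fun β : CntPV => β.toFun W) hα))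
            (hU (Set.mem_image_of_mem _ hW)) }

/-- The complete lattice `Cnt(PV)`. -/
instance : CompleteLattice CntPV :=
  completeLatticeOfSup CntPV fun _ => by
    constructor
    · intro α hα V
      exact le_sSup (Set.mem_image_of_mem (fun β : CntPV => β.toFun V) hα)
    · intro β hβ V
      apply sSup_le
      rintro _ ⟨α, hα, rfl⟩
      exact hβ hα V

/-- The identity operator on `PV`. -/
instance : One CntPV where
  one := { toFun := id, continuous := fun _ _ _ _ h => by simpa using h }

end CntPV

/-- `Cnt(PV)⁻`: the lattice of continuous operators below the identity operator. -/
abbrev CntPVMinus : Type 1 := Set.Iic (1 : CntPV)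

/-- A relational morphism `S → T` of finite semigroups. -/
@[ext]
structure RelMor (S T : FinSgp) : Type where
  rel : S → Set T
  nonempty : ∀ s, (rel s).Nonempty
  mul_mem : ∀ {s₁ s₂ : S} {t₁ t₂ : T}, t₁ ∈ rel s₁ → t₂ ∈ rel s₂ → t₁ * t₂ ∈ rel (s₁ * s₂)

namespace RelMor

/-- The identity of `S`. -/
def id (S : FinSgp) : RelMor S S where
  rel s := {s}
  nonempty s := ⟨s, rfl⟩
  mul_mem := by
    rintro s₁ s₂ _ _ rfl rfl
    rfl

/-- The composite relational morphism, `f` first. -/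
def comp {S T U : FinSgp} (f : RelMor S T) (g : RelMor T U) : RelMor S U where
  rel s := {u | ∃ t ∈ f.rel s, u ∈ g.rel t}
  nonempty s := by
    obtain ⟨t, ht⟩ := f.nonempty s
    obtain ⟨u, hu⟩ := g.nonempty t
    exact ⟨u, t, ht, hu⟩
  mul_mem := by
    rintro s₁ s₂ u₁ u₂ ⟨t₁, h₁, k₁⟩ ⟨t₂, h₂, k₂⟩
    exact ⟨t₁ * t₂, f.mul_mem h₁ h₂, g.mul_mem k₁ k₂⟩

/-- The direct product of two relational morphisms. -/
def prod {S T U V : FinSgp} (f : RelMor S T) (g : RelMor U V) :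
    RelMor (S.prod U) (T.prod V) where
  rel p := f.rel p.1 ×ˢ g.rel p.2
  nonempty p := (f.nonempty p.1).prod (g.nonempty p.2)
  mul_mem h k := ⟨f.mul_mem h.1 k.1, g.mul_mem h.2 k.2⟩

/-- A division is a relational morphism under which distinct elements have disjoint images. -/
def IsDivision {S T : FinSgp} (d : RelMor S T) : Prop :=
  ∀ s s' : S, (d.rel s ∩ d.rel s').Nonempty → s = s'

end RelMor

/-- A continuously closed class of relational morphisms: it contains the identity of the trivial
semigroup, and is closed under direct products, and under passing from `g` to a relational morphism
contained (as a relation) in `d₁ g d₂`, where `d₁` and `d₂` are divisions. -/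
structure CC : Type 1 where
  carrier : ∀ S T : FinSgp, Set (RelMor S T)
  id_mem : RelMor.id FinSgp.triv ∈ carrier FinSgp.triv FinSgp.triv
  prod_mem : ∀ {S T U V : FinSgp} {f : RelMor S T} {g : RelMor U V},
    f ∈ carrier S T → g ∈ carrier U V → f.prod g ∈ carrier (S.prod U) (T.prod V)
  div_mem : ∀ {S T U V : FinSgp} {f : RelMor S T} {g : RelMor U V}
    {d₁ : RelMor S U} {d₂ : RelMor V T}, d₁.IsDivision → d₂.IsDivision →
    (∀ s, f.rel s ⊆ ((d₁.comp g).comp d₂).rel s) → g ∈ carrier U V → f ∈ carrier S T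

namespace CC

theorem carrier_injective : Function.Injective CC.carrier := by
  rintro ⟨a, _⟩ ⟨b, _⟩ h
  cases h
  rfl

/-- Continuously closed classes are ordered by inclusion. -/
instance : PartialOrder CC := PartialOrder.lift CC.carrier carrier_injective

/-- The infimum of a family of continuously closed classes is their intersection. -/
instance : InfSet CC where
  sInf A :=
    { carrier := fun S T => {f | ∀ R ∈ A, f ∈ R.carrier S T}
      id_mem := fun R _ => R.id_mem
      prod_mem := fun hf hg R hR => R.prod_mem (hf R hR) (hg R hR)
      div_mem := fun h₁ h₂ h hg R hR => R.div_mem h₁ h₂ h (hg R hR) }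

/-- The complete lattice `CC`. -/
instance : CompleteLattice CC :=
  completeLatticeOfInf CC fun _ =>
    ⟨fun R hR _ _ _ hf => hf R hR, fun _ hW _ _ _ hf _ hR => hW hR _ _ hf⟩

/-- The continuously closed class `D` of all divisions. -/
def divisions : CC where
  carrier S T := {d | d.IsDivision}
  id_mem _ _ _ := rfl
  prod_mem := by
    rintro S T U V f g hf hg p q ⟨x, hp, hq⟩
    exact Prod.ext (hf _ _ ⟨x.1, hp.1, hq.1⟩) (hg _ _ ⟨x.2, hp.2, hq.2⟩)
  div_mem := by
    rintro S T U V f g d₁ d₂ h₁ h₂ hfg hg s s' ⟨x, hs, hs'⟩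
    obtain ⟨v, ⟨u, hu, hv⟩, hx⟩ := hfg s hs
    obtain ⟨v', ⟨u', hu', hv'⟩, hx'⟩ := hfg s' hs'
    obtain rfl : v = v' := h₂ _ _ ⟨x, hx, hx'⟩
    obtain rfl : u = u' := hg _ _ ⟨v, hv, hv'⟩
    exact h₁ _ _ ⟨u, hu, hu'⟩

end CC

/-- `CC⁻`: the lattice of continuously closed classes consisting of divisions. -/
abbrev CCMinus : Type 1 := Set.Iic CC.divisions

/-! In both lattices directed joins are computed as unions. Hence a class generated by one
relational morphism is compact in `CC`, and a step function `step S T` is compact in `CntPV`; these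
elements lie join-densely. Absence of atoms rests on `PV.exists_notMem_gen`: no finite semigroup
generates all of them.

If `step S T ≤ α` with `T` nontrivial, take `U` outside `gen S`: then `step (S.prod U) T` is a
nonbottom element below `α`, strictly so because it is trivial at `gen S`. If `f : S → T` lies in
`R` with `S` nontrivial, take `U` outside `gen T` and enlarge the codomain to `T × U`: the result
generates a nonbottom subclass of `R` that misses `f`, as `CC.codomainGenerates` shows. The two
remaining lattices are principal ideals and inherit both properties. -/

namespace FinSgp

/-! ### Periods of finite semigroups -/

/-- The semigroups of index at most `i + 1` and period dividing `p`. -/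
def HasPeriod (i p : ℕ) (S : FinSgp) : Prop :=
  ∀ x : S, (x * ·)^[i + p] x = (x * ·)^[i] x

/-- Pigeonhole on the finitely many self-maps of `S`, rather than on powers of one element, makes
the exponents uniform in `x`. -/
theorem exists_hasPeriod (S : FinSgp) : ∃ i p : ℕ, 0 < p ∧ S.HasPeriod i p := by
  obtain ⟨i, j, hij, h⟩ := Finite.exists_ne_map_eq_of_infinite
    fun (n : ℕ) (x : S) => (x * ·)^[n] x
  rcases lt_or_gt_of_ne hij with hlt | hlt
  · refine ⟨i, j - i, by omega, fun x => ?_⟩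
    rw [Nat.add_sub_cancel' hlt.le]
    exact (congrFun h x).symm
  · refine ⟨j, i - j, by omega, fun x => ?_⟩
    rw [Nat.add_sub_cancel' hlt.le]
    exact congrFun h x

/-- The cyclic group of order `p + 1`. -/
def cyclic (p : ℕ) : FinSgp := ⟨Multiplicative (ZMod (p + 1))⟩

theorem not_hasPeriod_cyclic (i : ℕ) {p : ℕ} (hp : 0 < p) : ¬ (cyclic p).HasPeriod i p := by
  intro h
  have key : (Multiplicative.ofAdd (1 : ZMod (p + 1)) * ·)^[i + p] (Multiplicative.ofAdd 1) =
      (Multiplicative.ofAdd (1 : ZMod (p + 1)) * ·)^[i] (Multiplicative.ofAdd 1) :=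
    h (Multiplicative.ofAdd (1 : ZMod (p + 1)))
  simp only [mul_left_iterate, mul_left_inj, pow_add, mul_eq_left] at key
  rw [← ofAdd_nsmul, ofAdd_eq_one, nsmul_one, ZMod.natCast_eq_zero_iff] at key
  -- The group has order `p + 1`, which cannot divide `p > 0`.
  exact absurd (Nat.le_of_dvd hp key) (by omega)

theorem semiconj_mul_left {S T : FinSgp} (f : S →ₙ* T) (x : S) :
    Function.Semiconj f (x * ·) (f x * ·) :=
  fun y => map_mul f x y

/-- The first projection of a direct product. -/
def fst (S T : FinSgp) : S.prod T →ₙ* S := ⟨Prod.fst, fun _ _ => rfl⟩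

/-- The second projection of a direct product. -/
def snd (S T : FinSgp) : S.prod T →ₙ* T := ⟨Prod.snd, fun _ _ => rfl⟩

theorem fst_surjective (S T : FinSgp) : Function.Surjective (fst S T) :=
  fun s => ⟨(s, Classical.arbitrary T), rfl⟩

theorem snd_surjective (S T : FinSgp) : Function.Surjective (snd S T) :=
  fun t => ⟨(Classical.arbitrary S, t), rfl⟩

end FinSgp

/-! ### Pseudovarieties and directed unions -/

namespace PV

theorem left_mem {V : PV} {S T : FinSgp} (h : S.prod T ∈ V.carrier) : S ∈ V.carrier :=
  V.quot_mem _ (FinSgp.fst_surjective S T) h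

theorem right_mem {V : PV} {S T : FinSgp} (h : S.prod T ∈ V.carrier) : T ∈ V.carrier :=
  V.quot_mem _ (FinSgp.snd_surjective S T) h

/-- The pseudovariety of semigroups satisfying `x ^ (i + p + 1) = x ^ (i + 1)`. -/
def ofPeriod (i p : ℕ) : PV where
  carrier := {S | S.HasPeriod i p}
  triv_mem _ := rfl
  prod_mem {S T} hS hT x := by
    refine Prod.ext ?_ ?_
    · have h (n : ℕ) := (FinSgp.semiconj_mul_left (FinSgp.fst S T) x).iterate_right n x
      exact (h _).trans ((hS _).trans (h _).symm)
    · have h (n : ℕ) := (FinSgp.semiconj_mul_left (FinSgp.snd S T) x).iterate_right n x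
      exact (h _).trans ((hT _).trans (h _).symm)
  sub_mem f hf hT x := by
    have h (n : ℕ) := (FinSgp.semiconj_mul_left f x).iterate_right n x
    exact hf ((h _).trans ((hT _).trans (h _).symm))
  quot_mem f hf hS y := by
    obtain ⟨x, rfl⟩ := hf y
    have h (n : ℕ) := (FinSgp.semiconj_mul_left f x).iterate_right n x
    rw [← h, ← h, hS x]

/-- The pseudovariety of trivial semigroups. -/
def trivial : PV where
  carrier := {S | Subsingleton S}
  triv_mem := inferInstanceAs (Subsingleton Unit)
  prod_mem {S T} (_ : Subsingleton S) (_ : Subsingleton T) :=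
    inferInstanceAs (Subsingleton (S × T))
  sub_mem _ hf (_ : Subsingleton _) := hf.subsingleton
  quot_mem _ hf (_ : Subsingleton _) := hf.subsingleton

theorem mem_of_subsingleton (V : PV) {S : FinSgp} [Subsingleton S] : S ∈ V.carrier :=
  V.sub_mem (⟨fun _ => (), fun _ _ => rfl⟩ : S →ₙ* FinSgp.triv)
    (Function.injective_of_subsingleton _) V.triv_mem

/-- The pseudovariety generated by a finite semigroup. -/
def gen (S : FinSgp) : PV := sInf {V | S ∈ V.carrier}

theorem mem_gen (S : FinSgp) : S ∈ (gen S).carrier := fun _ hV => hV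

theorem gen_le {S : FinSgp} {V : PV} : gen S ≤ V ↔ S ∈ V.carrier :=
  ⟨fun h => h (mem_gen S), fun h => sInf_le (a := V) h⟩

/-- The identity `x ^ (i + p + 1) = x ^ (i + 1)` valid in `S` passes to all of `gen S`, but fails in
the cyclic group of order `p + 1`. -/
theorem exists_notMem_gen (S : FinSgp) : ∃ T : FinSgp, T ∉ (gen S).carrier := by
  obtain ⟨i, p, hp, h⟩ := S.exists_hasPeriod
  exact ⟨FinSgp.cyclic p, fun hT => FinSgp.not_hasPeriod_cyclic i hp (hT (ofPeriod i p) h)⟩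

/-- The union of a nonempty directed set of pseudovarieties. -/
def directedUnion (d : Set PV) (hne : d.Nonempty) (hdir : DirectedOn (· ≤ ·) d) : PV where
  carrier := {S | ∃ V ∈ d, S ∈ V.carrier}
  triv_mem := hne.imp fun V hV => ⟨hV, V.triv_mem⟩
  prod_mem := by
    rintro S T ⟨V, hV, hS⟩ ⟨W, hW, hT⟩
    obtain ⟨X, hX, hVX, hWX⟩ := hdir V hV W hW
    exact ⟨X, hX, X.prod_mem (hVX hS) (hWX hT)⟩
  sub_mem := fun f hf ⟨V, hV, hT⟩ => ⟨V, hV, V.sub_mem f hf hT⟩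
  quot_mem := fun f hf ⟨V, hV, hS⟩ => ⟨V, hV, V.quot_mem f hf hS⟩

theorem exists_mem_of_isLUB {d : Set PV} (hne : d.Nonempty) (hdir : DirectedOn (· ≤ ·) d) {V : PV}
    (hV : IsLUB d V) {S : FinSgp} (hS : S ∈ V.carrier) : ∃ W ∈ d, S ∈ W.carrier := by
  have h : V ≤ directedUnion d hne hdir := hV.2 fun W hW T hT => ⟨W, hW, hT⟩
  exact h hS

end PV

/-! ### Continuous operators -/

namespace CntPV

open Classical in
/-- The step function sending the pseudovarieties that contain `S` to the pseudovariety generated by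
`T`, and all others to the trivial one. -/
noncomputable def step (S T : FinSgp) : CntPV where
  toFun V := if S ∈ V.carrier then PV.gen T else PV.trivial
  continuous := by
    have htriv (V : PV) : PV.trivial ≤ V := fun T (_ : Subsingleton T) => V.mem_of_subsingleton
    intro d hne hdir V hV
    constructor
    · rintro _ ⟨W, hW, rfl⟩
      by_cases h : S ∈ W.carrier
      · simp only [if_pos h, if_pos (hV.1 hW h), le_refl]
      · simpa only [if_neg h] using htriv _
    · intro U hU
      by_cases h : S ∈ V.carrier
      · obtain ⟨W, hW, hS⟩ := PV.exists_mem_of_isLUB hne hdir hV h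
        simpa only [if_pos h, if_pos hS] using hU (Set.mem_image_of_mem _ hW)
      · simpa only [if_neg h] using htriv U

theorem step_of_mem {S : FinSgp} (T : FinSgp) {V : PV} (h : S ∈ V.carrier) :
    (step S T).toFun V = PV.gen T := if_pos h

theorem step_of_notMem {S : FinSgp} (T : FinSgp) {V : PV} (h : S ∉ V.carrier) :
    (step S T).toFun V = PV.trivial := if_neg h

theorem step_le {S T : FinSgp} {α : CntPV} :
    step S T ≤ α ↔ T ∈ (α.toFun (PV.gen S)).carrier := by
  constructor
  · intro h
    have := h (PV.gen S)
    rw [step_of_mem T (PV.mem_gen S)] at this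
    exact PV.gen_le.1 this
  · intro h V
    by_cases hS : S ∈ V.carrier
    · rw [step_of_mem T hS]
      exact PV.gen_le.2 (α.continuous.monotone (PV.gen_le.2 hS) h)
    · rw [step_of_notMem T hS]
      exact fun U (_ : Subsingleton U) => PV.mem_of_subsingleton _

/-- A continuous operator is determined by its values on pseudovarieties generated by a single
semigroup. -/
theorem exists_step_le {α : CntPV} {V : PV} {T : FinSgp} (h : T ∈ (α.toFun V).carrier) :
    ∃ S ∈ V.carrier, step S T ≤ α := by
  -- `V` is the directed join of its principal subpseudovarieties, so continuity puts `T` in the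
  -- image of one of them.
  have hlub : IsLUB (PV.gen '' V.carrier) V := by
    constructor
    · rintro _ ⟨S, hS, rfl⟩
      exact PV.gen_le.2 hS
    · exact fun U hU S hS => PV.gen_le.1 (hU ⟨S, hS, rfl⟩)
  have hdir : DirectedOn (· ≤ ·) (PV.gen '' V.carrier) := by
    rintro _ ⟨S, hS, rfl⟩ _ ⟨T, hT, rfl⟩
    exact ⟨_, ⟨S.prod T, V.prod_mem hS hT, rfl⟩, PV.gen_le.2 (PV.left_mem (PV.mem_gen _)),
      PV.gen_le.2 (PV.right_mem (PV.mem_gen _))⟩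
  have hne : (PV.gen '' V.carrier).Nonempty := ⟨_, _, V.triv_mem, rfl⟩
  obtain ⟨_, ⟨_, ⟨S, hS, rfl⟩, rfl⟩, hT⟩ := PV.exists_mem_of_isLUB (hne.image α.toFun)
    (hdir.mono_comp fun _ _ => α.continuous.monotone.imp) (α.continuous hne hdir hlub) h
  exact ⟨S, hS, step_le.2 hT⟩

theorem isCompactElement_step (S T : FinSgp) : IsCompactElement (step S T) := by
  intro A u hne hdir hu hle
  obtain rfl : sSup A = u := (isLUB_sSup A).unique hu
  have hmem : T ∈ (sSup ((fun α : CntPV => α.toFun (PV.gen S)) '' A)).carrier := step_le.1 hle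
  obtain ⟨_, ⟨α, hα, rfl⟩, hT⟩ := PV.exists_mem_of_isLUB (hne.image _)
    (hdir.mono_comp fun _ _ h => h (PV.gen S)) (isLUB_sSup _) hmem
  exact ⟨α, hα, step_le.2 hT⟩

instance : IsCompactlyGenerated CntPV where
  exists_sSup_eq α := by
    refine ⟨{β | β ≤ α ∧ ∃ S T, β = step S T}, ?_, le_antisymm (sSup_le fun _ h => h.1) ?_⟩
    · rintro _ ⟨_, S, T, rfl⟩
      exact isCompactElement_step S T
    · intro V T hT
      obtain ⟨S, hS, hle⟩ := exists_step_le hT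
      have := le_sSup (show step S T ∈ {β | β ≤ α ∧ ∃ S T, β = step S T} from ⟨hle, S, T, rfl⟩) V
      rw [step_of_mem T hS] at this
      exact PV.gen_le.1 this

theorem step_ne_bot (S : FinSgp) {T : FinSgp} (hT : ¬ Subsingleton T) : step S T ≠ ⊥ := by
  intro h
  -- Evaluated at `gen S`, this would put `T` in `gen FinSgp.triv`, which contains only trivial
  -- semigroups.
  have hle : step S T ≤ step S FinSgp.triv := h ▸ bot_le
  rw [step_le, step_of_mem _ (PV.mem_gen S)] at hle
  exact hT (hle PV.trivial PV.trivial.triv_mem)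

theorem not_isAtom (α : CntPV) : ¬ IsAtom α := by
  intro hα
  obtain ⟨V, T, hT, hTn⟩ : ∃ V : PV, ∃ T ∈ (α.toFun V).carrier, ¬ Subsingleton T := by
    by_contra! h
    exact hα.1 (le_bot_iff.1 fun V T hT =>
      have := h V T hT
      PV.mem_of_subsingleton _)
  obtain ⟨S, -, hle⟩ := exists_step_le hT
  obtain ⟨U, hU⟩ := PV.exists_notMem_gen S
  have hle' : step (S.prod U) T ≤ α := step_le.2
    (α.continuous.monotone (PV.gen_le.2 (PV.left_mem (PV.mem_gen _))) (step_le.1 hle))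
  have heq : step (S.prod U) T = α := (hα.le_iff.1 hle').resolve_left (step_ne_bot _ hTn)
  have hmem := step_le.1 hle
  rw [← heq, step_of_notMem _ fun h => hU (PV.right_mem h)] at hmem
  exact hTn hmem

end CntPV

/-! ### Relational morphisms and divisions -/

namespace RelMor

theorem isDivision_id (S : FinSgp) : (RelMor.id S).IsDivision := by
  rintro s s' ⟨x, rfl, rfl⟩
  rfl

theorem isDivision_of_subsingleton {S T : FinSgp} [Subsingleton S] (d : RelMor S T) :
    d.IsDivision := fun _ _ _ => Subsingleton.elim _ _

/-- The relational morphism relating all elements. -/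
def full (S T : FinSgp) : RelMor S T where
  rel _ := Set.univ
  nonempty _ := Set.univ_nonempty
  mul_mem _ _ := Set.mem_univ _

/-- The graph of a relational morphism. -/
def graph {S T : FinSgp} (f : RelMor S T) : Subsemigroup (S × T) where
  carrier := {p | p.2 ∈ f.rel p.1}
  mul_mem' h k := f.mul_mem h k

theorem exists_mem_graph {S T : FinSgp} (f : RelMor S T) (s : S) : ∃ p : f.graph, p.1.1 = s := by
  obtain ⟨t, ht⟩ := f.nonempty s
  exact ⟨⟨(s, t), ht⟩, rfl⟩

/-- The graph of a relational morphism as a finite semigroup. -/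
def graphSgp {S T : FinSgp} (f : RelMor S T) : FinSgp :=
  haveI : Nonempty f.graph := (f.exists_mem_graph (Classical.arbitrary S)).nonempty
  ⟨f.graph⟩

/-- The graph of a division embeds in the codomain and maps onto the domain. -/
theorem IsDivision.mem {S T : FinSgp} {d : RelMor S T} (hd : d.IsDivision) {V : PV}
    (hT : T ∈ V.carrier) : S ∈ V.carrier := by
  let π₁ : d.graphSgp →ₙ* S := ⟨fun p => p.1.1, fun _ _ => rfl⟩
  let π₂ : d.graphSgp →ₙ* T := ⟨fun p => p.1.2, fun _ _ => rfl⟩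
  refine V.quot_mem π₁ d.exists_mem_graph (V.sub_mem π₂ ?_ hT)
  rintro ⟨⟨s, t⟩, hp⟩ ⟨⟨s', t'⟩, hq⟩ (rfl : t = t')
  obtain rfl := hd s s' ⟨t, hp, hq⟩
  rfl

theorem subsingleton_of_subset_comp {S T U V : FinSgp} {f : RelMor S T} {g : RelMor U V}
    {d₁ : RelMor S U} {d₂ : RelMor V T} (h₁ : d₁.IsDivision)
    (_ : ∀ s, f.rel s ⊆ ((d₁.comp g).comp d₂).rel s) [Subsingleton U] : Subsingleton S :=
  ⟨fun s s' => h₁ s s' <| by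
    obtain ⟨u, hu⟩ := d₁.nonempty s
    obtain ⟨u', hu'⟩ := d₁.nonempty s'
    obtain rfl := Subsingleton.elim u u'
    exact ⟨u, hu, hu'⟩⟩

end RelMor

/-! ### Continuously closed classes -/

namespace CC

/-- The union of a nonempty directed set of continuously closed classes. -/
def directedUnion (d : Set CC) (hne : d.Nonempty) (hdir : DirectedOn (· ≤ ·) d) : CC where
  carrier S T := {f | ∃ R ∈ d, f ∈ R.carrier S T}
  id_mem := hne.imp fun R hR => ⟨hR, R.id_mem⟩
  prod_mem := by
    rintro S T U V f g ⟨R, hR, hf⟩ ⟨R', hR', hg⟩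
    obtain ⟨X, hX, h, h'⟩ := hdir R hR R' hR'
    exact ⟨X, hX, X.prod_mem (h _ _ hf) (h' _ _ hg)⟩
  div_mem := fun h₁ h₂ h ⟨R, hR, hg⟩ => ⟨R, hR, R.div_mem h₁ h₂ h hg⟩

/-- The continuously closed class generated by a relational morphism. -/
def gen {S T : FinSgp} (f : RelMor S T) : CC := sInf {R | f ∈ R.carrier S T}

theorem mem_gen {S T : FinSgp} (f : RelMor S T) : f ∈ (gen f).carrier S T := fun _ hR => hR

theorem gen_le {S T : FinSgp} {f : RelMor S T} {R : CC} : gen f ≤ R ↔ f ∈ R.carrier S T :=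
  ⟨fun h => h _ _ (mem_gen f), fun h => sInf_le (a := R) h⟩

theorem isCompactElement_gen {S T : FinSgp} (f : RelMor S T) : IsCompactElement (gen f) := by
  intro d u hne hdir hu hle
  have h : u ≤ directedUnion d hne hdir := hu.2 fun R hR _ _ _ hg => ⟨R, hR, hg⟩
  obtain ⟨R, hR, hf⟩ := h _ _ (gen_le.1 hle)
  exact ⟨R, hR, gen_le.2 hf⟩

instance : IsCompactlyGenerated CC where
  exists_sSup_eq R := by
    refine ⟨{X | X ≤ R ∧ ∃ (S T : FinSgp) (f : RelMor S T), X = gen f}, ?_,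
      le_antisymm (sSup_le fun _ h => h.1) ?_⟩
    · rintro _ ⟨_, S, T, f, rfl⟩
      exact isCompactElement_gen f
    · exact fun S T f hf => gen_le.1 (le_sSup ⟨gen_le.2 hf, S, T, f, rfl⟩)

/-- The relational morphisms with trivial domain. -/
def trivial : CC where
  carrier S _ := {_f | Subsingleton S}
  id_mem := inferInstanceAs (Subsingleton Unit)
  prod_mem {S _ U _ _ _} (_ : Subsingleton S) (_ : Subsingleton U) :=
    inferInstanceAs (Subsingleton (S × U))
  div_mem h₁ _ h (_ : Subsingleton _) := RelMor.subsingleton_of_subset_comp h₁ h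

theorem mem_of_subsingleton (R : CC) {S T : FinSgp} [Subsingleton S] (f : RelMor S T) :
    f ∈ R.carrier S T := by
  let s₀ : S := Classical.arbitrary S
  have hs (s : S) : s = s₀ := Subsingleton.elim s s₀
  let d : RelMor FinSgp.triv T :=
    { rel := fun _ => f.rel s₀
      nonempty := fun _ => f.nonempty s₀
      mul_mem := fun h k => hs (s₀ * s₀) ▸ f.mul_mem h k }
  have : Subsingleton FinSgp.triv := inferInstanceAs (Subsingleton Unit)
  -- Any relation with trivial domain is a division, so `f` factors through the identity of the
  -- trivial semigroup with divisions on both sides.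
  refine R.div_mem (d₁ := RelMor.full S FinSgp.triv) (d₂ := d) (RelMor.isDivision_of_subsingleton _)
    (RelMor.isDivision_of_subsingleton _) (fun s t ht => ?_) R.id_mem
  rw [hs s] at ht
  exact ⟨(), ⟨(), Set.mem_univ _, rfl⟩, ht⟩

/-- The relational morphisms whose domain is trivial or whose codomain generates a pseudovariety
containing `U`. -/
def codomainGenerates (U : FinSgp) : CC where
  carrier S T := {_f | Subsingleton S ∨ U ∈ (PV.gen T).carrier}
  id_mem := Or.inl (inferInstanceAs (Subsingleton Unit))
  prod_mem := by
    rintro S T S' T' f g (hS | hT) (hS' | hT')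
    · exact Or.inl (inferInstanceAs (Subsingleton (S × S')))
    · exact Or.inr (PV.gen_le.2 (PV.right_mem (PV.mem_gen _)) hT')
    · exact Or.inr (PV.gen_le.2 (PV.left_mem (PV.mem_gen _)) hT)
    · exact Or.inr (PV.gen_le.2 (PV.left_mem (PV.mem_gen _)) hT)
  div_mem := by
    rintro S T S' T' f g d₁ d₂ h₁ h₂ h (hS | hT)
    · exact Or.inl (RelMor.subsingleton_of_subset_comp h₁ h)
    · exact Or.inr (PV.gen_le.2 (h₂.mem (PV.mem_gen T)) hT)

/-- Enlarging the codomain of a relational morphism by a direct factor. -/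
theorem enlarge_mem (R : CC) {S T : FinSgp} {f : RelMor S T} (hf : f ∈ R.carrier S T) (U : FinSgp) :
    ∃ g : RelMor S (T.prod U), g ∈ R.carrier S (T.prod U) := by
  have : Subsingleton FinSgp.triv := inferInstanceAs (Subsingleton Unit)
  let d : RelMor S (S.prod FinSgp.triv) :=
    { rel := fun s => {(s, ())}
      nonempty := fun s => ⟨_, rfl⟩
      mul_mem := by
        rintro s₁ s₂ _ _ rfl rfl
        rfl }
  have hd : d.IsDivision := by
    rintro s s' ⟨x, rfl, h⟩
    exact congrArg Prod.fst h
  -- `f` times the full relation from the trivial semigroup to `U` has domain `S × 1`; precomposing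
  -- with `d` restores the domain `S`.
  exact ⟨_, R.div_mem hd (RelMor.isDivision_id _) (fun _ => subset_rfl)
    (R.prod_mem hf (R.mem_of_subsingleton (RelMor.full FinSgp.triv U)))⟩

theorem not_isAtom (R : CC) : ¬ IsAtom R := by
  intro hR
  obtain ⟨S, T, f, hf, hS⟩ : ∃ (S T : FinSgp) (f : RelMor S T), f ∈ R.carrier S T ∧
      ¬ Subsingleton S := by
    by_contra! h
    exact hR.1 (le_bot_iff.1 fun S T f hf =>
      have := h S T f hf
      mem_of_subsingleton _ f)
  obtain ⟨U, hU⟩ := PV.exists_notMem_gen T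
  obtain ⟨g, hg⟩ := R.enlarge_mem hf U
  have hg' : gen g ≤ codomainGenerates U := gen_le.2 (Or.inr (PV.right_mem (PV.mem_gen _)))
  rcases hR.le_iff.1 (gen_le.2 hg) with h | h
  · have hle : gen g ≤ trivial := h ▸ bot_le
    exact hS (gen_le.1 hle)
  -- If `gen g = R`, then `f` lies in `codomainGenerates U`, against the choices of `S` and `U`.
  · rw [h] at hg'
    exact (hg' _ _ hf).elim hS hU

end CC

theorem mainTheorem8 :
    (IsCompactlyGenerated CC ∧ ∀ R : CC, ¬ IsAtom R) ∧
    (IsCompactlyGenerated CCMinus ∧ ∀ R : CCMinus, ¬ IsAtom R) ∧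
    (IsCompactlyGenerated CntPV ∧ ∀ α : CntPV, ¬ IsAtom α) ∧
    (IsCompactlyGenerated CntPVMinus ∧ ∀ α : CntPVMinus, ¬ IsAtom α) :=
  ⟨⟨inferInstance, CC.not_isAtom⟩,
    ⟨inferInstance, fun R hR => CC.not_isAtom R.1 hR.of_isAtom_coe_Iic⟩,
    ⟨inferInstance, CntPV.not_isAtom⟩,
    ⟨inferInstance, fun α hα => CntPV.not_isAtom α.1 hα.of_isAtom_coe_Iic⟩⟩
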